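/- Let $\mathcal C$ be a locally finitely presented Grothendieck category. A \emph{localizing subcategory} of $\mathcal C$ is a full Serre subcategory $\mathcal S$ (containing $0$ and closed under isomorphisms, subobjects, quotients and extensions) that is closed under direct limits; $t_{\mathcal S}(X)$ denotes the largest subobject of $X$ belonging to $\mathcal S$. The quotient category $\mathcal C/\mathcal S$ is the full subcategory of \emph{$\mathcal S$-closed} objects, i.e. of those $M\in\mathcal C$ with $\operatorname{Hom}(X,M)=\operatorname{Ext}^1(X,M)=0$ for all $X\in\mathcal S$. A localizing subcategory $\mathcal S$ is \emph{of finite type} if the inclusion functor $\mathcal C/\mathcal S\to\mathcal C$ preserves directed sums, i.e. directed unions of subobjects (equivalently, colimits of directed systems of monomorphisms). The \emph{join} of a collection of localizing subcategories is the smallest localizing subcategory containing all of them. Let $\operatorname{Inj}\mathcal C$ be the injective spectrum, the set of isomorphism classes of indecomposable injective objects of $\mathcal C$, and for a localizing subcategory $\mathcal S$ of finite type put $$O(\mathcal S)=\{E\in\operatorname{Inj}\mathcal C \mid t_{\mathcal S}(E)\neq 0\}.$$ Then the following hold. (1) The collection of all sets $O(\mathcal S)$, with $\mathcal S$ a localizing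 subcategory of finite type in $\mathcal C$, is the collection of open sets of a topology on $\operatorname{Inj}\mathcal C$ (the fl-topology). (2) The map $\mathcal S\mapsto O(\mathcal S)$ is a bijection between the localizing subcategories of finite type in $\mathcal C$ and the open subsets for the fl-topology, and it preserves and reflects inclusions: for $\mathcal S,\mathcal Q$ of finite type, $\mathcal S\subseteq\mathcal Q$ if and only if $O(\mathcal S)\subseteq O(\mathcal Q)$. (3) The intersection of finitely many localizing subcategories of finite type is a localizing subcategory of finite type, and the join of an arbitrary collection of localizing subcategories of finite type is a localizing subcategory of finite type. -/

import Mathlib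

universe v u

open CategoryTheory CategoryTheory.Limits Topology

noncomputable section

namespace FiniteLocalization

variable {C : Type u} [Category.{v} C] [Abelian C]

/-- A (full, replete) subcategory of a Grothendieck category is localizing if it is a Serre
subcategory which is closed under direct limits. -/
structure IsLocalizing (S : ObjectProperty C) : Prop where
  isSerreClass : S.IsSerreClass
  closed_directLimit : ∀ (J : Type v) [SmallCategory J] [IsFiltered J],
    S.IsClosedUnderColimitsOfShape J

/-- `surd X` is the smallest localizing subcategory containing `X`, that is, the intersection of
all localizing subcategories that contain `X`. -/
def surd (X : ObjectProperty C) : ObjectProperty C :=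
  fun A => ∀ S : ObjectProperty C, IsLocalizing S → X ≤ S → S A

/-- The intersection of a collection of subcategories. -/
def inter (F : Set (ObjectProperty C)) : ObjectProperty C :=
  fun A => ∀ S ∈ F, S A

/-- The union of a collection of subcategories. -/
def union (F : Set (ObjectProperty C)) : ObjectProperty C :=
  fun A => ∃ S ∈ F, S A

/-- The join of a collection of subcategories: the smallest localizing subcategory containing
all of them. -/
def join (F : Set (ObjectProperty C)) : ObjectProperty C :=
  surd (union F)

variable [IsGrothendieckAbelian.{v} C]

/-- The `S`-closed objects: those `M` with `Hom(X, M) = 0` and `Ext¹(X, M) = 0` for all `X` in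
`S`. -/
def closedObjects (S : ObjectProperty C) : ObjectProperty C :=
  fun M => ∀ X : C, S X → Subsingleton (X ⟶ M) ∧ Subsingleton (Abelian.Ext.{v} X M 1)

/-- The quotient category `C/S`, realized as the full subcategory of `S`-closed objects. -/
abbrev QuotientCategory (S : ObjectProperty C) : Type u :=
  (closedObjects S).FullSubcategory

/-- The inclusion functor `i : C/S ⥤ C`. -/
abbrev inclusion (S : ObjectProperty C) : QuotientCategory S ⥤ C :=
  (closedObjects S).ι

/-- A localizing subcategory `S` is of finite type if the inclusion `i : C/S ⥤ C` preserves
directed sums (directed unions of subobjects), that is, colimits of directed systems in `C/S`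
all of whose transition morphisms are monomorphisms of `C/S`. -/
structure IsFiniteType (S : ObjectProperty C) : Prop where
  isLocalizing : IsLocalizing S
  preservesDirectedSums : ∀ (J : Type v) [Preorder J] [IsDirectedOrder J] [Nonempty J]
    (F : J ⥤ QuotientCategory S), (∀ (i j : J) (f : i ⟶ j), Mono (F.map f)) →
      PreservesColimit F (inclusion S)

/-- The torsion part `t_S(X)`: the largest subobject of `X` belonging to `S`, as the sum of all
subobjects of `X` that belong to `S`. -/
def torsion (S : ObjectProperty C) (X : C) : Subobject X :=
  sSup {Y : Subobject X | S (Y : C)}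

variable (C)

/-- The indecomposable (in particular nonzero) injective objects. -/
def indecomposableInjectives : ObjectProperty C :=
  fun E => Injective E ∧ Indecomposable E

/-- The injective spectrum: isomorphism classes of indecomposable injective objects. -/
def InjSpectrum : Type u :=
  Quotient (isIsomorphicSetoid (indecomposableInjectives C).FullSubcategory)

variable {C}

/-- The isomorphism class of an indecomposable injective object. -/
def InjSpectrum.mk (E : (indecomposableInjectives C).FullSubcategory) : InjSpectrum C :=
  Quotient.mk (isIsomorphicSetoid (indecomposableInjectives C).FullSubcategory) E

/-- `O(S)`: the classes of the indecomposable injective objects `E` with `t_S(E) ≠ 0`. -/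
def openSet (S : ObjectProperty C) : Set (InjSpectrum C) :=
  {x | ∃ E : (indecomposableInjectives C).FullSubcategory,
    InjSpectrum.mk E = x ∧ torsion S E.obj ≠ ⊥}

end FiniteLocalization

end

/-!
The localizing subcategory `S` is of finite type if and only if `S`-dense subobjects of finitely
presentable objects can be detected on finitely presentable objects: every morphism from a finitely
presentable `P` to an object of `S` is killed by a morphism `Q ⟶ P` with `Q` finitely presentable
and cokernel in `S`. For a fixed Serre class of admissible cokernels this condition itself defines a
localizing subcategory, which makes joins of finite type localizing subcategories of finite type;
for intersections one uses biproducts.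

If `Q` is of finite type and `S` is not contained in `Q`, Zorn's lemma on the subobjects of a
finitely presentable object that are not dense yields an object of `S` outside `Q` all of whose
proper quotients are in `Q`. It is uniform and `Q`-torsion-free, so its injective hull is
indecomposable and belongs to `O(S)` but not to `O(Q)`; hence `O` reflects inclusions. It takes
joins to unions because the objects without nonzero morphisms to an injective object form a
localizing subcategory, and meets to intersections because indecomposable injectives are uniform.
-/

namespace FiniteLocalization

section Presentable

variable {C : Type u} [Category.{v} C]

theorem isSeparating_isFinitelyPresentable [IsLocallyFinitelyPresentable.{v} C] :
    (ObjectProperty.isFinitelyPresentable.{v} C).IsSeparating := by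
  have : Fact (Cardinal.aleph0.{v}).IsRegular := Cardinal.fact_isRegular_aleph0
  obtain ⟨G, _, hG⟩ := HasCardinalFilteredGenerator.exists_generator C Cardinal.aleph0.{v}
  exact fun X Y f g h =>
    hG.isStrongGenerator.isSeparating f g fun P hP p => h P (hG.le_isCardinalPresentable P hP) p

theorem hom_ext_of_presentable [IsLocallyFinitelyPresentable.{v} C] {X Y : C} {f g : X ⟶ Y}
    (h : ∀ (P : C) [IsFinitelyPresentable.{v} P] (p : P ⟶ X), p ≫ f = p ≫ g) : f = g :=
  isSeparating_isFinitelyPresentable f g fun P (_ : IsFinitelyPresentable.{v} P) p => h P p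

theorem isClosedUnderColimitsOfShape_isFinitelyPresentable (J : Type) [SmallCategory J]
    [FinCategory J] :
    (ObjectProperty.isFinitelyPresentable.{v} C).IsClosedUnderColimitsOfShape J := by
  have : Fact (Cardinal.aleph0.{v}).IsRegular := Cardinal.fact_isRegular_aleph0
  exact isClosedUnderColimitsOfShape_isCardinalPresentable (κ := Cardinal.aleph0.{v}) C
    (by rw [hasCardinalLT_aleph0_iff]; infer_instance)

theorem isFinitelyPresentable_of_isZero {Z : C} (hZ : IsZero Z) :
    IsFinitelyPresentable.{v} Z := by
  have := isClosedUnderColimitsOfShape_isFinitelyPresentable (C := C) (Discrete PEmpty)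
  exact (ObjectProperty.isFinitelyPresentable.{v} C).prop_of_isColimit
    (isColimitChangeEmptyCocone C hZ.isInitial (asEmptyCocone Z) (Iso.refl _)) (by rintro ⟨⟨⟩⟩)

theorem isFinitelyPresentable_biprod [Preadditive C] [HasBinaryBiproducts C] (P Q : C)
    [IsFinitelyPresentable.{v} P] [IsFinitelyPresentable.{v} Q] :
    IsFinitelyPresentable.{v} (P ⊞ Q) := by
  have := isClosedUnderColimitsOfShape_isFinitelyPresentable (C := C) (Discrete WalkingPair)
  refine (ObjectProperty.isFinitelyPresentable.{v} C).prop_of_isColimit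
    (BinaryBiproduct.isColimit P Q) ?_
  rintro ⟨_ | _⟩ <;> assumption

end Presentable

section Subobject

variable {C : Type u} [Category.{v} C] [Abelian C] {X Y Z : C}

theorem factors_iff_comp_cokernel_eq_zero (A : Subobject X) (f : Y ⟶ X) :
    A.Factors f ↔ f ≫ cokernel.π A.arrow = 0 := by
  constructor
  · intro h
    rw [← Subobject.factorThru_arrow _ _ h, Category.assoc, cokernel.condition, comp_zero]
  · intro h
    rw [← Abelian.monoLift_comp A.arrow f h]
    exact Subobject.factors_comp_arrow _

theorem comp_cokernel_eq_zero_iff_up_to_refinements (w : X ⟶ Y) (f : Z ⟶ Y) :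
    f ≫ cokernel.π w = 0 ↔ ∃ (K : C) (s : K ⟶ Z) (_ : Epi s) (r : K ⟶ X), s ≫ f = r ≫ w :=
  CokernelCofork.IsColimit.comp_π_eq_zero_iff_up_to_refinements (cokernelIsCokernel w) f

theorem imageSubobject_factors_self (f : X ⟶ Y) : (imageSubobject f).Factors f := by
  simpa using imageSubobject_factors_comp_self f (𝟙 X)

end Subobject

section DirectedSup

variable {C : Type u} [Category.{v} C] [Abelian C] [IsGrothendieckAbelian.{v} C] {X : C}

section Family

variable {J : Type v} [Preorder J] (D : J →o Subobject X)

/-- The supremum of a monotone family of subobjects as a cocone over the family. -/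
noncomputable def iSupCocone :
    Cocone ((D.monotone.functor ⋙ Subobject.representative) ⋙ MonoOver.forget X) where
  pt := Over.mk (⨆ j, D j).arrow
  ι :=
    { app := fun j => Over.homMk (Subobject.ofLE _ _ (le_iSup D j)) (Subobject.ofLE_arrow _)
      naturality := fun i j f => by
        ext
        apply (cancel_mono (⨆ j, D j).arrow).1
        exact (Over.w _).trans (Over.w _).symm }

/-- AB5: a directed supremum of subobjects is their colimit. -/
noncomputable def isColimitISupCocone [IsDirectedOrder J] [Nonempty J] :
    IsColimit ((Over.forget X).mapCocone (iSupCocone D)) := by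
  have : Mono (iSupCocone D).pt.hom := inferInstanceAs (Mono (⨆ j, D j).arrow)
  refine IsGrothendieckAbelian.isColimitMapCoconeOfSubobjectMkEqISup _ (iSupCocone D) ?_
  exact (Subobject.mk_arrow _).trans (iSup_congr fun j => (Subobject.mk_arrow (D j)).symm)

end Family

variable {T : Set (Subobject X)}

theorem exists_orderHom_range_eq (hT : T.Nonempty) (hd : DirectedOn (· ≤ ·) T) :
    ∃ (J : Type v) (_ : Preorder J) (_ : IsDirectedOrder J) (_ : Nonempty J)
      (D : J →o Subobject X), Set.range D = T := by
  have := hT.to_subtype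
  have := hd.isDirectedOrder
  let e := orderIsoShrink.{v} T
  refine ⟨Shrink.{v} T, inferInstance, ⟨fun i j => ?_⟩, e.symm.surjective.nonempty,
    ⟨fun j => e.symm j, fun _ _ h => e.symm.monotone h⟩, ?_⟩
  · obtain ⟨A, hi, hj⟩ := exists_ge_ge (e.symm i) (e.symm j)
    exact ⟨e A, e.symm_apply_le.1 hi, e.symm_apply_le.1 hj⟩
  · exact (e.symm.surjective.range_comp Subtype.val).trans Subtype.range_coe

theorem exists_factors_of_directed {P : C} [IsFinitelyPresentable.{v} P] (hT : T.Nonempty)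
    (hd : DirectedOn (· ≤ ·) T) (f : P ⟶ X) (hf : (sSup T).Factors f) : ∃ A ∈ T, A.Factors f := by
  obtain ⟨J, _, _, _, D, rfl⟩ := exists_orderHom_range_eq hT hd
  rw [sSup_range] at hf
  obtain ⟨j, (p : P ⟶ (D j : C)), (hp : p ≫ Subobject.ofLE _ _ (le_iSup D j) = _)⟩ :=
    IsFinitelyPresentable.exists_hom_of_isColimit (isColimitISupCocone D)
      (Subobject.factorThru _ f hf)
  have hpf : p ≫ (D j).arrow = f := by
    rw [← Subobject.factorThru_arrow _ f hf, ← hp, Category.assoc, Subobject.ofLE_arrow]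
  exact ⟨D j, ⟨j, rfl⟩, hpf ▸ Subobject.factors_comp_arrow p⟩

theorem mono_of_directed {Z : C} (hT : T.Nonempty) (hd : DirectedOn (· ≤ ·) T)
    (g : ((sSup T : Subobject X) : C) ⟶ Z)
    (hg : ∀ A (hA : A ∈ T), Mono (Subobject.ofLE A _ (le_sSup hA) ≫ g)) : Mono g := by
  obtain ⟨J, _, _, _, D, rfl⟩ := exists_orderHom_range_eq hT hd
  let c := (Over.forget X).mapCocone (iSupCocone D)
  let φ : _ ⟶ (Functor.const J).obj Z := c.ι ≫ (Functor.const J).map g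
  have (j : J) : Mono (φ.app j) := hg _ ⟨j, rfl⟩
  have := NatTrans.mono_of_mono_app φ
  have := IsFiltered.isConnected J
  exact colim.map_mono' φ (isColimitISupCocone D) (isColimitConstCocone J Z) g
    fun j => (Category.comp_id _).symm

end DirectedSup

section PresentableImages

variable {C : Type u} [Category.{v} C] [Abelian C] {X Y : C}

/-- The images of the finitely presentable pieces of the source of a morphism. In a locally finitely
presentable Grothendieck category they form a directed set whose union is the whole image. -/
def presentableImages (f : Y ⟶ X) : Set (Subobject X) :=
  {A | ∃ (Q : C) (_ : IsFinitelyPresentable.{v} Q) (q : Q ⟶ Y), imageSubobject (q ≫ f) = A}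

theorem presentableImages_nonempty (f : Y ⟶ X) : (presentableImages f).Nonempty :=
  ⟨_, _, isFinitelyPresentable_of_isZero (isZero_zero C), 0, rfl⟩

theorem directedOn_presentableImages (f : Y ⟶ X) : DirectedOn (· ≤ ·) (presentableImages f) := by
  rintro _ ⟨Q₁, _, q₁, rfl⟩ _ ⟨Q₂, _, q₂, rfl⟩
  refine ⟨_, ⟨Q₁ ⊞ Q₂, isFinitelyPresentable_biprod _ _, biprod.desc q₁ q₂, rfl⟩, ?_, ?_⟩
  · simpa using imageSubobject_comp_le biprod.inl (biprod.desc q₁ q₂ ≫ f)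
  · simpa using imageSubobject_comp_le biprod.inr (biprod.desc q₁ q₂ ≫ f)

variable [IsGrothendieckAbelian.{v} C] [IsLocallyFinitelyPresentable.{v} C]

theorem sSup_presentableImages_factors (f : Y ⟶ X) : (sSup (presentableImages f)).Factors f := by
  rw [factors_iff_comp_cokernel_eq_zero]
  refine hom_ext_of_presentable fun Q _ q => ?_
  rw [comp_zero, ← Category.assoc, ← factors_iff_comp_cokernel_eq_zero]
  exact Subobject.factors_of_le _ (le_sSup ⟨Q, inferInstance, q, rfl⟩)
    (imageSubobject_factors_self _)

/-- A finitely presentable object is finitely generated. -/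
theorem exists_presentable_epi [IsFinitelyPresentable.{v} X] (e : Y ⟶ X) [Epi e] :
    ∃ (Q : C) (_ : IsFinitelyPresentable.{v} Q) (q : Q ⟶ Y), Epi (q ≫ e) := by
  have htop : (sSup (presentableImages e)).Factors (𝟙 X) := by
    rw [factors_iff_comp_cokernel_eq_zero, ← cancel_epi e, comp_zero, Category.id_comp,
      ← factors_iff_comp_cokernel_eq_zero]
    exact sSup_presentableImages_factors e
  obtain ⟨_, ⟨Q, hQ, q, rfl⟩, hq⟩ := exists_factors_of_directed
    (presentableImages_nonempty e) (directedOn_presentableImages e) (𝟙 X) htop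
  refine ⟨Q, hQ, q, Abelian.epi_of_cokernel_π_eq_zero _ ?_⟩
  have : (imageSubobject (q ≫ e)).arrow ≫ cokernel.π (q ≫ e) = 0 := by
    simp only [← cancel_epi (factorThruImageSubobject (q ≫ e)), imageSubobject_arrow_comp_assoc,
      cokernel.condition, comp_zero]
  rw [← Category.id_comp (cokernel.π _), ← Subobject.factorThru_arrow _ _ hq, Category.assoc, this,
    comp_zero]

end PresentableImages

section Torsion

variable {C : Type u} [Category.{v} C] [Abelian C] {S : ObjectProperty C} {X Y Z : C}

theorem rightOrthogonal_of_mono (hY : S.rightOrthogonal Y) (i : X ⟶ Y) [Mono i] :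
    S.rightOrthogonal X :=
  fun Z f hZ => by rw [← cancel_mono i, hY (f ≫ i) hZ, zero_comp]

theorem prop_of_prop_kernel [S.IsSerreClass] (f : X ⟶ Y) (hf : S (kernel f)) (hY : S Y) : S X :=
  S.prop_X₂_of_exact (ShortComplex.exact_of_f_is_kernel
    (ShortComplex.mk (kernel.ι f) f (kernel.condition f)) (kernelIsKernel f)) hf hY

theorem prop_imageSubobject [S.IsSerreClass] (f : X ⟶ Y) (hX : S X) : S (imageSubobject f : C) :=
  S.prop_of_epi (factorThruImageSubobject f) hX

theorem prop_cokernel_of_fac [S.IsSerreClass] {f : X ⟶ Y} {g : Y ⟶ Z} {k : X ⟶ Z} (w : f ≫ g = k)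
    (hk : S (cokernel k)) : S (cokernel g) := by
  let m : cokernel k ⟶ cokernel g := cokernel.desc _ (cokernel.π g) (by simp [← w])
  have : Epi m := epi_of_epi_fac (cokernel.π_desc _ _ _)
  exact S.prop_of_epi m hk

theorem eq_zero_of_comp_eq_zero {q : X ⟶ Y} (hq : S (cokernel q)) (hZ : S.rightOrthogonal Z)
    {f : Y ⟶ Z} (hf : q ≫ f = 0) : f = 0 := by
  rw [← cokernel.π_desc q f hf, hZ (cokernel.desc q f hf) hq, comp_zero]

variable [IsGrothendieckAbelian.{v} C]

theorem IsLocalizing.prop_sSup (hS : IsLocalizing S) {T : Set (Subobject X)} (hT : T.Nonempty)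
    (hd : DirectedOn (· ≤ ·) T) (h : ∀ A ∈ T, S (A : C)) : S ((sSup T : Subobject X) : C) := by
  obtain ⟨J, _, _, _, D, rfl⟩ := exists_orderHom_range_eq hT hd
  have := hS.closed_directLimit J
  exact S.prop_of_isColimit (isColimitISupCocone D) fun j => h _ ⟨j, rfl⟩

theorem IsLocalizing.prop_torsion (hS : IsLocalizing S) (X : C) : S (torsion S X : C) := by
  have := hS.isSerreClass
  refine hS.prop_sSup ⟨⊥, S.prop_of_iso (Subobject.botCoeIsoZero (B := X)).symm S.prop_zero⟩
    (fun A hA B hB => ?_) fun A hA => hA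
  refine ⟨imageSubobject (biprod.desc A.arrow B.arrow),
    prop_imageSubobject _ (S.prop_biprod hA hB), Subobject.le_of_factors ?_,
    Subobject.le_of_factors ?_⟩
  · simpa using imageSubobject_factors_comp_self (biprod.desc A.arrow B.arrow) biprod.inl
  · simpa using imageSubobject_factors_comp_self (biprod.desc A.arrow B.arrow) biprod.inr

theorem factors_torsion [S.IsSerreClass] (f : X ⟶ Y) (hX : S X) : (torsion S Y).Factors f :=
  Subobject.factors_of_le f (le_sSup (prop_imageSubobject f hX)) (imageSubobject_factors_self f)

theorem torsion_eq_bot_iff [S.IsSerreClass] : torsion S Y = ⊥ ↔ S.rightOrthogonal Y := by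
  refine ⟨fun h X f hX => ?_, fun h => sSup_eq_bot.2 fun A hA => ?_⟩
  · exact (Subobject.bot_factors_iff_zero f).1 (h ▸ factors_torsion f hX)
  · rw [← Subobject.mk_arrow A, ← Subobject.mk_eq_bot_iff_zero.2 (h A.arrow hA)]

theorem IsLocalizing.rightOrthogonal_cokernel_torsion (hS : IsLocalizing S) (X : C) :
    S.rightOrthogonal (cokernel (torsion S X).arrow) := by
  have := hS.isSerreClass
  intro Z f hZ
  let p := cokernel.π (torsion S X).arrow
  have hp : S.monoModSerre p :=
    S.prop_of_epi (Abelian.factorThruImage (torsion S X).arrow) (hS.prop_torsion X)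
  have hsnd : S.monoModSerre (pullback.snd p f) :=
    MorphismProperty.pullback_snd (P := S.monoModSerre) p f hp
  have hP : S (pullback p f) := prop_of_prop_kernel _ hsnd hZ
  have hfst : pullback.fst p f ≫ p = 0 :=
    (factors_iff_comp_cokernel_eq_zero _ _).1 (factors_torsion _ hP)
  rw [← cancel_epi (pullback.snd p f), ← pullback.condition, hfst, comp_zero]

end Torsion

section Essential

variable {C : Type u} [Category.{v} C] {V D E : C}

/-- A monomorphism `i : V ⟶ E` is essential if a morphism out of `E` is a monomorphism as soon
as its restriction to `V` is. -/
structure IsEssentialMono (i : V ⟶ E) : Prop where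
  mono : Mono i
  mono_of_comp : ∀ ⦃Z : C⦄ (g : E ⟶ Z), Mono (i ≫ g) → Mono g

theorem IsEssentialMono.comp {i : V ⟶ D} {j : D ⟶ E} (hi : IsEssentialMono i)
    (hj : IsEssentialMono j) : IsEssentialMono (i ≫ j) where
  mono :=
    have := hi.mono
    have := hj.mono
    mono_comp i j
  mono_of_comp _ g hg := hj.mono_of_comp g (hi.mono_of_comp _ (by rwa [← Category.assoc]))

theorem IsEssentialMono.of_isIso (i : V ⟶ E) [IsIso i] : IsEssentialMono i where
  mono := inferInstance
  mono_of_comp _ g hg := by simpa using mono_comp (inv i) (i ≫ g)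

variable [Abelian C] {S Q : ObjectProperty C}

theorem mono_comp_cokernel_symm (d : D ⟶ E) (b : V ⟶ E) [Mono d] (h : Mono (b ≫ cokernel.π d)) :
    Mono (d ≫ cokernel.π b) := by
  refine Preadditive.mono_of_cancel_zero _ fun f hf => ?_
  rw [← Category.assoc, comp_cokernel_eq_zero_iff_up_to_refinements] at hf
  obtain ⟨K, s, _, r, hr⟩ := hf
  have hr₀ : r = 0 := zero_of_comp_mono (b ≫ cokernel.π d) (by simp [← reassoc_of% hr])
  rw [hr₀, zero_comp] at hr
  exact zero_of_comp_mono d (zero_of_epi_comp s hr)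

theorem IsEssentialMono.eq_zero_of_pullback_fst {i : V ⟶ E} (hi : IsEssentialMono i) (b : D ⟶ E)
    (hb : pullback.fst i b = 0) : b = 0 := by
  have : Mono (i ≫ cokernel.π b) := by
    refine Preadditive.mono_of_cancel_zero _ fun g hg => ?_
    rw [← Category.assoc, comp_cokernel_eq_zero_iff_up_to_refinements] at hg
    obtain ⟨K, s, _, r, hr⟩ := hg
    rw [← cancel_epi s, comp_zero, ← pullback.lift_fst (s ≫ g) r (by rwa [Category.assoc]), hb,
      comp_zero]
  have := hi.mono_of_comp _ this
  exact zero_of_comp_mono _ (cokernel.condition b)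

theorem IsEssentialMono.rightOrthogonal [S.IsSerreClass] {i : V ⟶ E} (hi : IsEssentialMono i)
    (hV : S.rightOrthogonal V) : S.rightOrthogonal E := by
  have := hi.mono
  exact fun X f hX => hi.eq_zero_of_pullback_fst f (hV _ (S.prop_of_mono (pullback.snd i f) hX))

end Essential

section Uniform

variable {C : Type u} [Category.{v} C] [Abelian C] {V E : C} {S Q : ObjectProperty C}

/-- An object is uniform if it is nonzero and all its nonzero subobjects are essential. -/
def IsUniform (V : C) : Prop :=
  ¬ IsZero V ∧ ∀ ⦃A : C⦄ (a : A ⟶ V) [Mono a], a ≠ 0 → IsEssentialMono a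

theorem IsUniform.mono_or_mono_of_mono_lift (hV : IsUniform V) {Y Z : C} (a : V ⟶ Y) (b : V ⟶ Z)
    [Mono (biprod.lift a b)] : Mono a ∨ Mono b := by
  refine or_iff_not_imp_left.2 fun ha => ?_
  have hι : kernel.ι a ≠ 0 := fun h => ha (Preadditive.mono_of_kernel_zero h)
  refine (hV.2 _ hι).mono_of_comp b (Preadditive.mono_of_cancel_zero _ fun f hf => ?_)
  refine zero_of_comp_mono (kernel.ι a ≫ biprod.lift a b) ?_
  ext <;> simp [hf]

theorem IsUniform.indecomposable_of_isEssentialMono (hV : IsUniform V) {i : V ⟶ E}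
    (hi : IsEssentialMono i) : Indecomposable E := by
  have := hi.mono
  refine ⟨fun hE => hV.1 (IsZero.of_mono i hE), fun Y Z e => ?_⟩
  have hlift : biprod.lift (i ≫ e.hom ≫ biprod.fst) (i ≫ e.hom ≫ biprod.snd) = i ≫ e.hom := by
    ext <;> simp
  have : Mono (biprod.lift (i ≫ e.hom ≫ biprod.fst) (i ≫ e.hom ≫ biprod.snd)) :=
    hlift ▸ mono_comp i e.hom
  rcases hV.mono_or_mono_of_mono_lift (i ≫ e.hom ≫ biprod.fst) (i ≫ e.hom ≫ biprod.snd) with h | h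
  · have := hi.mono_of_comp _ h
    exact .inr (IsZero.of_mono_eq_zero (biprod.inr ≫ e.inv)
      (zero_of_comp_mono (e.hom ≫ biprod.fst) (by simp)))
  · have := hi.mono_of_comp _ h
    exact .inl (IsZero.of_mono_eq_zero (biprod.inl ≫ e.inv)
      (zero_of_comp_mono (e.hom ≫ biprod.snd) (by simp)))

theorem IsUniform.rightOrthogonal_or_of_inf [S.IsSerreClass] [Q.IsSerreClass] (hE : IsUniform E)
    (h : (S ⊓ Q).rightOrthogonal E) : S.rightOrthogonal E ∨ Q.rightOrthogonal E := by
  by_contra! ⟨hS, hQ⟩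
  simp only [ObjectProperty.rightOrthogonal, not_forall] at hS hQ
  obtain ⟨X, f, hX, hf⟩ := hS
  obtain ⟨Y, g, hY, hg⟩ := hQ
  have hA : (imageSubobject f).arrow ≠ 0 := fun h => hf (by
    rw [← imageSubobject_arrow_comp f, h, comp_zero])
  let p := pullback.fst (imageSubobject f).arrow (imageSubobject g).arrow
  let q := pullback.snd (imageSubobject f).arrow (imageSubobject g).arrow
  have hp : p = 0 := zero_of_comp_mono _ (h (p ≫ (imageSubobject f).arrow)
    ⟨S.prop_of_mono p (prop_imageSubobject f hX), Q.prop_of_mono q (prop_imageSubobject g hY)⟩)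
  have hB := (hE.2 _ hA).eq_zero_of_pullback_fst _ hp
  exact hg (by rw [← imageSubobject_arrow_comp g, hB, comp_zero])

end Uniform

section Hull

variable {C : Type u} [Category.{v} C] [Abelian C] {V D E : C}

theorem mono_of_kernelSubobject_le {Z : Subobject V} (a : cokernel Z.arrow ⟶ E)
    (h : kernelSubobject (cokernel.π Z.arrow ≫ a) ≤ Z) : Mono a := by
  refine Preadditive.mono_of_cancel_zero _ fun f hf => ?_
  have hsnd : pullback.snd f (cokernel.π Z.arrow) ≫ cokernel.π Z.arrow = 0 := by
    rw [← factors_iff_comp_cokernel_eq_zero]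
    refine Subobject.factors_of_le _ h (kernelSubobject_factors _ _ ?_)
    rw [← pullback.condition_assoc, hf, comp_zero]
  rw [← cancel_epi (pullback.fst f (cokernel.π Z.arrow)), comp_zero, pullback.condition, hsnd]

theorem shortExact_cokernel {A B : C} (i : A ⟶ B) [Mono i] :
    (ShortComplex.mk i (cokernel.π i) (cokernel.condition i)).ShortExact where
  exact := ShortComplex.exact_of_g_is_cokernel _ (cokernelIsCokernel i)
  mono_f := ‹Mono i›
  epi_g := inferInstance

theorem exists_iso_biprod_of_isSplitMono (h : D ⟶ E) [IsSplitMono h] :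
    Nonempty (E ≅ D ⊞ cokernel h) := by
  have hh := shortExact_cokernel h
  exact ⟨(ShortComplex.Splitting.ofExactOfRetraction _ hh.exact (retraction h) (IsSplitMono.id h)
    hh.epi_g).isoBinaryBiproduct⟩

variable [IsGrothendieckAbelian.{v} C]

theorem exists_isEssentialMono_comp_cokernel (d : D ⟶ E) [Mono d] :
    ∃ B : Subobject E, IsEssentialMono (d ≫ cokernel.π B.arrow) := by
  have hchain (T : Set (Subobject E)) (hT : T ⊆ {B | Mono (d ≫ cokernel.π B.arrow)})
      (hc : IsChain (· ≤ ·) T) (hne : T.Nonempty) : Mono (d ≫ cokernel.π (sSup T).arrow) := by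
    refine mono_comp_cokernel_symm _ _ (mono_of_directed hne hc.directedOn _ fun A hA => ?_)
    have : Mono (d ≫ cokernel.π A.arrow) := hT hA
    simpa using mono_comp_cokernel_symm A.arrow d this
  have hbot : Mono (d ≫ cokernel.π (⊥ : Subobject E).arrow) :=
    mono_comp_cokernel_symm _ _
      (IsZero.mono (Subobject.botCoeIsoZero.isZero_iff.2 (isZero_zero C)) _)
  obtain ⟨B, -, hB⟩ := zorn_le_nonempty₀ {B : Subobject E | Mono (d ≫ cokernel.π B.arrow)}
    (fun T hT hc A hA => ⟨sSup T, hchain T hT hc ⟨A, hA⟩, fun _ => le_sSup⟩) ⊥ hbot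
  refine ⟨B, hB.prop, fun Z g hg => ?_⟩
  let K := kernelSubobject (cokernel.π B.arrow ≫ g)
  have hK : Mono (d ≫ cokernel.π K.arrow) := by
    have hfac : (d ≫ cokernel.π K.arrow) ≫ cokernel.desc _ (cokernel.π B.arrow ≫ g)
        (kernelSubobject_arrow_comp _) = (d ≫ cokernel.π B.arrow) ≫ g := by simp
    have : Mono ((d ≫ cokernel.π K.arrow) ≫ _) := hfac ▸ hg
    exact mono_of_mono _ (cokernel.desc _ (cokernel.π B.arrow ≫ g) (kernelSubobject_arrow_comp _))
  exact mono_of_kernelSubobject_le g (hB.le_of_ge hK (le_kernelSubobject _ _ (by simp)))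

theorem exists_maximal_isEssentialMono (v : V ⟶ E) [Mono v] :
    ∃ D : Subobject E, Maximal
      (fun D => ∃ h : Subobject.mk v ≤ D, IsEssentialMono (Subobject.ofMkLE v D h)) D := by
  let P (D : Subobject E) := ∃ h : Subobject.mk v ≤ D, IsEssentialMono (Subobject.ofMkLE v D h)
  have hself : P (Subobject.mk v) := by
    have h : Subobject.ofMkLE v (Subobject.mk v) le_rfl = (Subobject.underlyingIso v).inv := by
      rw [← cancel_mono (Subobject.mk v).arrow]
      simp
    exact ⟨le_rfl, h ▸ .of_isIso _⟩
  have hchain (T : Set (Subobject E)) (hT : ∀ A ∈ T, P A) (hc : IsChain (· ≤ ·) T)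
      (hne : T.Nonempty) : P (sSup T) := by
    refine ⟨(hT _ hne.some_mem).choose.trans (le_sSup hne.some_mem), inferInstance,
      fun Z g hg => mono_of_directed hne hc.directedOn g fun A hA => ?_⟩
    obtain ⟨hvA, hess⟩ := hT A hA
    refine hess.mono_of_comp _ ?_
    rwa [← Category.assoc, Subobject.ofMkLE_comp_ofLE]
  obtain ⟨D, -, hD⟩ := zorn_le_nonempty₀ {D | P D}
    (fun T hT hc A hA => ⟨sSup T, hchain T hT hc ⟨A, hA⟩, fun _ => le_sSup⟩) _ hself
  exact ⟨D, hD⟩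

theorem exists_injective_hull (V : C) : ∃ (E : C) (i : V ⟶ E), Injective E ∧ IsEssentialMono i := by
  obtain ⟨D, hD⟩ := exists_maximal_isEssentialMono (Injective.ι V)
  obtain ⟨hVD, hess⟩ := hD.prop
  obtain ⟨B, hB⟩ := exists_isEssentialMono_comp_cokernel D.arrow
  have := hB.mono
  let k := D.arrow ≫ cokernel.π B.arrow
  let j := Injective.factorThru D.arrow k
  have hkj : k ≫ j = D.arrow := Injective.comp_factorThru _ _
  have : Mono j := hB.mono_of_comp j (by rw [hkj]; infer_instance)
  have hDj : D ≤ Subobject.mk j := Subobject.le_mk_of_comm k hkj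
  have hofMkLE : Subobject.ofMkLE _ (Subobject.mk j) (hVD.trans hDj) =
      Subobject.ofMkLE _ D hVD ≫ k ≫ (Subobject.underlyingIso j).inv := by
    rw [← cancel_mono (Subobject.mk j).arrow]
    simp [hkj]
  have hjD : Subobject.mk j ≤ D :=
    hD.le_of_ge ⟨hVD.trans hDj, hofMkLE ▸ hess.comp (hB.comp (.of_isIso _))⟩ hDj
  let r : Retract (D : C) (Injective.under V) :=
    { i := D.arrow
      r := cokernel.π B.arrow ≫ Subobject.ofMkLE j D hjD
      retract := by
        rw [← Category.assoc, ← cancel_mono D.arrow, Category.assoc, Subobject.ofMkLE_arrow,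
          Category.id_comp]
        exact hkj }
  exact ⟨D, Subobject.ofMkLE _ D hVD, r.injective, hess⟩

theorem isUniform_of_indecomposable_injective [Injective E] (hE : Indecomposable E) :
    IsUniform E := by
  refine ⟨hE.1, fun A a _ ha => ?_⟩
  obtain ⟨H, i, _, hi⟩ := exists_injective_hull A
  have := hi.mono
  let h := Injective.factorThru a i
  have hih : i ≫ h = a := Injective.comp_factorThru _ _
  have : Mono h := hi.mono_of_comp h (hih ▸ inferInstance)
  have : IsSplitMono h := ⟨⟨⟨Injective.factorThru (𝟙 H) h, Injective.comp_factorThru _ _⟩⟩⟩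
  obtain ⟨e⟩ := exists_iso_biprod_of_isSplitMono h
  rcases hE.2 _ _ e with hz | hz
  · exact absurd (by rw [← hih, hz.eq_of_src h 0, comp_zero]) ha
  · have : Epi h := Abelian.epi_of_cokernel_π_eq_zero _ (hz.eq_of_tgt _ _)
    have := isIso_of_mono_of_epi h
    exact hih ▸ hi.comp (.of_isIso h)

end Hull

section Closed

variable {C : Type u} [Category.{v} C] [Abelian C] [IsGrothendieckAbelian.{v} C]
  {S : ObjectProperty C} {M : C}

theorem rightOrthogonal_of_closedObjects (hM : closedObjects S M) : S.rightOrthogonal M :=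
  fun X f hX => (hM X hX).1.elim f 0

theorem closedObjects_X₁_of_shortExact {T : ShortComplex C} (hT : T.ShortExact)
    (h₂ : closedObjects S T.X₂) (h₃ : S.rightOrthogonal T.X₃) : closedObjects S T.X₁ := by
  intro X hX
  have := hT.mono_f
  have h₁ := rightOrthogonal_of_mono (rightOrthogonal_of_closedObjects h₂) T.f
  refine ⟨⟨fun f g => by rw [h₁ f hX, h₁ g hX]⟩, subsingleton_of_forall_eq 0 fun x => ?_⟩
  obtain ⟨y, rfl⟩ := Abelian.Ext.covariant_sequence_exact₁ X hT x
    ((h₂ X hX).2.elim _ _) (n₀ := 0) rfl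
  obtain ⟨g, rfl⟩ := (Abelian.Ext.mk₀_bijective _ _).2 y
  rw [h₃ g hX, Abelian.Ext.mk₀_zero, Abelian.Ext.zero_comp]

theorem rightOrthogonal_X₃_of_shortExact {T : ShortComplex C} (hT : T.ShortExact)
    (h₁ : closedObjects S T.X₁) (h₂ : S.rightOrthogonal T.X₂) : S.rightOrthogonal T.X₃ := by
  intro X f hX
  obtain ⟨y, hy⟩ := Abelian.Ext.covariant_sequence_exact₃ X hT (Abelian.Ext.mk₀ f) rfl
    ((h₁ X hX).2.elim _ _)
  obtain ⟨g, rfl⟩ := (Abelian.Ext.mk₀_bijective _ _).2 y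
  apply (Abelian.Ext.mk₀_bijective _ _).1
  rw [← hy, h₂ g hX, Abelian.Ext.mk₀_zero, Abelian.Ext.zero_comp, Abelian.Ext.mk₀_zero]

theorem closedObjects_of_injective {E : C} [Injective E] (hE : S.rightOrthogonal E) :
    closedObjects S E := fun X hX =>
  ⟨⟨fun f g => by rw [hE f hX, hE g hX]⟩, Abelian.Ext.subsingleton_of_injective X E 0⟩

theorem closedObjects_of_iso {N : C} (e : N ≅ M) (hM : closedObjects S M) : closedObjects S N :=
  closedObjects_X₁_of_shortExact (shortExact_cokernel e.hom) hM
    fun _ _ _ => (isZero_cokernel_of_epi e.hom).eq_of_tgt _ _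

theorem exists_comp_eq_of_closedObjects [S.IsSerreClass] (hM : closedObjects S M) {A B : C}
    {f : A ⟶ B} (hf : S (cokernel f)) {g : A ⟶ M} (hg : kernel.ι f ≫ g = 0) :
    ∃ k : B ⟶ M, f ≫ k = g := by
  let i := Abelian.factorThruCoimage f
  obtain ⟨x, hx⟩ := Abelian.Ext.contravariant_sequence_exact₁ (shortExact_cokernel i) M
    (Abelian.Ext.mk₀ (cokernel.desc _ g hg)) (n₁ := 1) rfl
    ((hM _ (prop_cokernel_of_fac (Abelian.coimage.fac f) hf)).2.elim _ _)
  obtain ⟨k, rfl⟩ := (Abelian.Ext.mk₀_bijective _ _).2 x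
  rw [Abelian.Ext.mk₀_comp_mk₀, (Abelian.Ext.mk₀_bijective _ _).1.eq_iff] at hx
  refine ⟨k, ?_⟩
  rw [← Abelian.coimage.fac f, Category.assoc, hx]
  exact cokernel.π_desc _ _ _

theorem isoModSerre_le_isLocal [S.IsSerreClass] : S.isoModSerre ≤ (closedObjects S).isLocal := by
  intro A B f ⟨hker, hcok⟩ M hM
  have htf := rightOrthogonal_of_closedObjects hM
  refine ⟨fun g h hgh => ?_, fun g => ?_⟩
  · refine sub_eq_zero.1 (eq_zero_of_comp_eq_zero hcok htf ?_)
    rw [Preadditive.comp_sub, sub_eq_zero]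
    exact hgh
  · exact exists_comp_eq_of_closedObjects hM hcok (htf (kernel.ι f ≫ g) hker)

end Closed

section Saturation

variable {C : Type u} [Category.{v} C] [Abelian C] [IsGrothendieckAbelian.{v} C]
  {S : ObjectProperty C} {A B E X Z : C}

/-- The `S`-saturation of a morphism `u`: the largest subobject of its target which becomes an
`S`-torsion object modulo the image of `u`. -/
noncomputable def saturation (S : ObjectProperty C) (u : A ⟶ E) : Subobject E :=
  kernelSubobject (cokernel.π u ≫ cokernel.π (torsion S (cokernel u)).arrow)

theorem saturation_factors_iff (u : A ⟶ E) (p : Z ⟶ E) :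
    (saturation S u).Factors p ↔ (torsion S (cokernel u)).Factors (p ≫ cokernel.π u) := by
  rw [saturation, kernelSubobject_factors_iff, factors_iff_comp_cokernel_eq_zero, Category.assoc]

theorem saturation_factors_self (u : A ⟶ E) : (saturation S u).Factors u :=
  (saturation_factors_iff u u).2 (by rw [cokernel.condition]; exact Subobject.factors_zero)

theorem IsLocalizing.saturation_comp_le (hS : IsLocalizing S) (k : A ⟶ B) (u : B ⟶ E) :
    saturation S (k ≫ u) ≤ saturation S u := by
  have := hS.isSerreClass
  refine Subobject.le_of_factors ((saturation_factors_iff _ _).2 ?_)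
  have h := (saturation_factors_iff (k ≫ u) _).1 (Subobject.factors_self (saturation S (k ≫ u)))
  have hfac : (saturation S (k ≫ u)).arrow ≫ cokernel.π u = (torsion S _).factorThru _ h ≫
      (torsion S _).arrow ≫ cokernel.desc (k ≫ u) (cokernel.π u) (by simp) := by
    simp
  rw [hfac]
  exact Subobject.factors_of_factors_right _ (factors_torsion _ (hS.prop_torsion _))

theorem IsLocalizing.closedObjects_saturation (hS : IsLocalizing S) (hE : closedObjects S E)
    (u : A ⟶ E) : closedObjects S (saturation S u : C) := by
  let g := cokernel.π u ≫ cokernel.π (torsion S (cokernel u)).arrow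
  let d : cokernel (saturation S u).arrow ⟶ _ := cokernel.desc _ g (kernelSubobject_arrow_comp g)
  have hd : cokernel.π (saturation S u).arrow ≫ d = g := cokernel.π_desc _ _ _
  have : Mono d := mono_of_kernelSubobject_le d (by rw [hd]; rfl)
  exact closedObjects_X₁_of_shortExact (shortExact_cokernel (saturation S u).arrow) hE
    (rightOrthogonal_of_mono (hS.rightOrthogonal_cokernel_torsion _) d)

theorem IsLocalizing.prop_cokernel_of_saturation_factors (hS : IsLocalizing S) {q : A ⟶ B}
    {u : B ⟶ E} (hu : S (kernel u)) (h : (saturation S (q ≫ u)).Factors u) :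
    S (cokernel q) := by
  have := hS.isSerreClass
  let m := cokernel.map q (q ≫ u) (𝟙 A) u (by simp)
  let t := torsion S (cokernel (q ≫ u))
  have hm : t.Factors m := by
    rw [saturation_factors_iff, factors_iff_comp_cokernel_eq_zero] at h
    rw [factors_iff_comp_cokernel_eq_zero, ← cancel_epi (cokernel.π q)]
    simpa [m] using h
  have hker : S (kernel m) := by
    let δ := kernelCokernelCompSequence.δ q u
    have hexact := kernelCokernelCompSequence_exact q u
    have hδ : δ ≫ m = 0 := ((kernelCokernelCompSequence q u).sc hexact.toIsComplex 2).zero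
    have : Epi (kernel.lift m δ hδ) :=
      (ShortComplex.exact_iff_epi_kernel_lift (.mk δ m hδ)).1 (hexact.exact 2)
    exact S.prop_of_epi (kernel.lift m δ hδ) hu
  have hmt : kernel.ι (t.factorThru m hm) ≫ m = 0 := by
    calc
      _ = kernel.ι (t.factorThru m hm) ≫ t.factorThru m hm ≫ t.arrow := by
        rw [Subobject.factorThru_arrow]
      _ = 0 := by rw [kernel.condition_assoc, zero_comp]
  exact prop_of_prop_kernel (t.factorThru m hm)
    (S.prop_of_mono (kernel.lift m _ hmt) hker) (hS.prop_torsion _)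

end Saturation

section Reflection

variable {C : Type u} [Category.{v} C] [Abelian C] [IsGrothendieckAbelian.{v} C]
  {S : ObjectProperty C}

theorem IsLocalizing.exists_injective_prop_kernel (hS : IsLocalizing S) (X : C) :
    ∃ (E : C) (u : X ⟶ E), Injective E ∧ closedObjects S E ∧ S (kernel u) := by
  have := hS.isSerreClass
  obtain ⟨E, i, _, hi⟩ := exists_injective_hull (cokernel (torsion S X).arrow)
  have := hi.mono
  refine ⟨E, cokernel.π _ ≫ i, inferInstance,
    closedObjects_of_injective (hi.rightOrthogonal (hS.rightOrthogonal_cokernel_torsion X)), ?_⟩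
  exact S.prop_of_iso (kernelCompMono _ i).symm
    (S.prop_of_epi (Abelian.factorThruImage (torsion S X).arrow) (hS.prop_torsion X))

theorem IsLocalizing.exists_isoModSerre_closedObjects (hS : IsLocalizing S) (X : C) :
    ∃ (M : C) (i : X ⟶ M), closedObjects S M ∧ S (kernel i) ∧ S (cokernel i) := by
  have := hS.isSerreClass
  obtain ⟨E, u, _, hE, hu⟩ := hS.exists_injective_prop_kernel X
  let M := saturation S u
  let i := M.factorThru u (saturation_factors_self u)
  have hi : i ≫ M.arrow = u := M.factorThru_arrow _ _
  refine ⟨M, i, hS.closedObjects_saturation hE u, ?_, ?_⟩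
  · refine S.prop_of_mono (kernel.lift u (kernel.ι i) ?_) hu
    rw [← hi, kernel.condition_assoc, zero_comp]
  · refine hS.prop_cokernel_of_saturation_factors (u := M.arrow) (S.monoModSerre_of_mono _) ?_
    rw [hi]
    exact Subobject.factors_self _

theorem IsLocalizing.isRightAdjoint_inclusion (hS : IsLocalizing S) :
    (inclusion S).IsRightAdjoint := by
  have := hS.isSerreClass
  choose M i hM hker hcok using hS.exists_isoModSerre_closedObjects
  let e (X : C) (N : QuotientCategory S) :
      ((⟨M X, hM X⟩ : QuotientCategory S) ⟶ N) ≃ (X ⟶ (inclusion S).obj N) :=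
    (closedObjects S).fullyFaithfulι.homEquiv.trans (Equiv.ofBijective (i X ≫ ·)
      (isoModSerre_le_isLocal _ ⟨hker X, hcok X⟩ _ N.property))
  exact ⟨_, ⟨Adjunction.adjunctionOfEquivLeft e
    fun X N N' g h => (Category.assoc (i X) h.hom g.hom).symm⟩⟩

end Reflection

section DirectedUnions

variable {C : Type u} [Category.{v} C] [Abelian C] [IsGrothendieckAbelian.{v} C]
  {S : ObjectProperty C}

theorem isFiniteType_iff_closedObjects_of_isColimit (hS : IsLocalizing S) :
    IsFiniteType S ↔ ∀ (J : Type v) [Preorder J] [IsDirectedOrder J] [Nonempty J] (F : J ⥤ C)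
      (c : Cocone F) (_ : IsColimit c), (∀ (i j : J) (f : i ⟶ j), Mono (F.map f)) →
      (∀ j, closedObjects S (F.obj j)) → closedObjects S c.pt := by
  have hadj := hS.isRightAdjoint_inclusion
  refine ⟨fun h J _ _ _ F c hc hmono hF => ?_, fun h => ⟨hS, fun J _ _ _ F hmono => ?_⟩⟩
  · let R : Reflective (inclusion S) := ⟨_, Adjunction.ofIsRightAdjoint _⟩
    have : HasColimitsOfShape J (QuotientCategory S) :=
      hasColimitsOfShape_of_reflective (inclusion S)
    let F' : J ⥤ QuotientCategory S := (closedObjects S).lift F hF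
    have := h.preservesDirectedSums J F' fun i j f =>
      (inclusion S).mono_of_mono_map (hmono i j f)
    exact closedObjects_of_iso (hc.coconePointUniqueUpToIso
      (isColimitOfPreserves (inclusion S) (colimit.isColimit F'))) (colimit F').property
  · have hcolim : closedObjects S (colimit (F ⋙ inclusion S)) :=
      h J _ _ (colimit.isColimit _) (fun i j f => have := hmono i j f
        (inclusion S).map_mono (F.map f)) fun j => (F.obj j).property
    let := createsColimitFullSubcategoryInclusion F hcolim
    infer_instance

theorem IsFiniteType.closedObjects_sSup (hS : IsFiniteType S) {E : C} {T : Set (Subobject E)}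
    (hT : T.Nonempty) (hd : DirectedOn (· ≤ ·) T) (h : ∀ A ∈ T, closedObjects S (A : C)) :
    closedObjects S ((sSup T : Subobject E) : C) := by
  obtain ⟨J, _, _, _, D, rfl⟩ := exists_orderHom_range_eq hT hd
  exact (isFiniteType_iff_closedObjects_of_isColimit hS.isLocalizing).1 hS J _ _
    (isColimitISupCocone D) (fun i j f => inferInstanceAs
      (Mono (Subobject.ofLE (D i) (D j) (D.monotone f.le)))) fun j => h _ ⟨j, rfl⟩

/-- Dense subobjects form a Gabriel topology of finite type: embed `P` modulo torsion into a closed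
injective object; there the saturations of the members of `T` have a closed directed union, which
must contain the image of `P`. -/
theorem IsFiniteType.exists_mem_prop_cokernel (hS : IsFiniteType S) {P : C}
    [IsFinitelyPresentable.{v} P] {T : Set (Subobject P)} (hT : T.Nonempty)
    (hd : DirectedOn (· ≤ ·) T) (h : S (cokernel (sSup T).arrow)) :
    ∃ A ∈ T, S (cokernel A.arrow) := by
  have hL := hS.isLocalizing
  obtain ⟨E, u, _, hE, hu⟩ := hL.exists_injective_prop_kernel P
  let sat (A : Subobject P) : Subobject E := saturation S (A.arrow ≫ u)
  have hmono : Monotone sat := fun A B hAB => by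
    simpa [sat] using hL.saturation_comp_le (Subobject.ofLE A B hAB) (B.arrow ≫ u)
  have hd' : DirectedOn (· ≤ ·) (sat '' T) := hd.mono_comp hmono
  let U : Subobject E := sSup (sat '' T)
  have hU : closedObjects S (U : C) := hS.closedObjects_sSup (hT.image _) hd'
    (Set.forall_mem_image.2 fun A _ => hL.closedObjects_saturation hE _)
  have hquot : S.rightOrthogonal (cokernel U.arrow) :=
    rightOrthogonal_X₃_of_shortExact (shortExact_cokernel U.arrow) hU
      (rightOrthogonal_of_closedObjects hE)
  have hle : sSup T ≤ kernelSubobject (u ≫ cokernel.π U.arrow) := sSup_le fun A hA => by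
    refine le_kernelSubobject _ _ ?_
    rw [← Category.assoc, ← factors_iff_comp_cokernel_eq_zero]
    exact Subobject.factors_of_le _ (le_sSup (Set.mem_image_of_mem sat hA))
      (saturation_factors_self _)
  have hzero : u ≫ cokernel.π U.arrow = 0 := by
    refine eq_zero_of_comp_eq_zero h hquot ?_
    rw [← kernelSubobject_factors_iff]
    exact Subobject.factors_of_le _ hle (Subobject.factors_self _)
  obtain ⟨_, ⟨A, hA, rfl⟩, hAu⟩ := exists_factors_of_directed (hT.image _) hd' u
    ((factors_iff_comp_cokernel_eq_zero _ _).2 hzero)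
  exact ⟨A, hA, hL.prop_cokernel_of_saturation_factors hu hAu⟩

end DirectedUnions

section FinitelyTorsion

variable {C : Type u} [Category.{v} C] [Abelian C]

/-- The objects that are torsion for `T` in a finitary way: every morphism into them from a finitely
presentable object `P` is killed by a morphism into `P` with finitely presentable source and
`T`-torsion cokernel. A localizing subcategory is of finite type if and only if its objects have
this property with respect to itself, see `isFiniteType_iff_le_finitelyTorsion`. -/
def finitelyTorsion (T : ObjectProperty C) : ObjectProperty C := fun X =>
  ∀ (P : C) [IsFinitelyPresentable.{v} P] (f : P ⟶ X),
    ∃ (Q : C) (_ : IsFinitelyPresentable.{v} Q) (q : Q ⟶ P), q ≫ f = 0 ∧ T (cokernel q)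

theorem finitelyTorsion_mono {S T : ObjectProperty C} (h : S ≤ T) :
    finitelyTorsion S ≤ finitelyTorsion T := fun _ hX P _ f =>
  let ⟨Q, hQ, q, hq, hS⟩ := hX P f
  ⟨Q, hQ, q, hq, h _ hS⟩

variable {S : ObjectProperty C}

variable [IsLocallyFinitelyPresentable.{v} C]

theorem rightOrthogonal_of_isColimit (hS : S ≤ finitelyTorsion S)
    {J : Type v} [SmallCategory J] [IsFiltered J] {F : J ⥤ C} {c : Cocone F} (hc : IsColimit c)
    (hF : ∀ j, S.rightOrthogonal (F.obj j)) : S.rightOrthogonal c.pt := by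
  refine fun X g hX => hom_ext_of_presentable fun P _ p => ?_
  obtain ⟨Q, _, q, hq, hQ⟩ := hS X hX P p
  obtain ⟨j, l, hl⟩ := IsFinitelyPresentable.exists_hom_of_isColimit hc (p ≫ g)
  obtain ⟨k, a, b, hab⟩ := IsFinitelyPresentable.exists_eq_of_isColimit hc (q ≫ l)
    (0 : Q ⟶ F.obj j) (by rw [Category.assoc, hl, reassoc_of% hq, zero_comp, zero_comp])
  have h : l ≫ F.map a = 0 := eq_zero_of_comp_eq_zero hQ (hF k) (by simpa using hab)
  rw [← hl, ← c.w a, ← Category.assoc, h, zero_comp, comp_zero]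

variable [IsGrothendieckAbelian.{v} C]

theorem isLocalizing_finitelyTorsion (T : ObjectProperty C) [T.IsSerreClass] :
    IsLocalizing (finitelyTorsion T) where
  isSerreClass :=
    { exists_zero := ⟨_, isZero_zero C, fun P _ f =>
        ⟨P, inferInstance, 𝟙 P, (isZero_zero C).eq_of_tgt _ _, T.epiModSerre_of_epi _⟩⟩
      prop_of_mono := fun i _ h P _ f => by
        obtain ⟨Q, hQ, q, hq, hT⟩ := h P (f ≫ i)
        exact ⟨Q, hQ, q, zero_of_comp_mono i (by rw [Category.assoc, hq]), hT⟩
      prop_of_epi := fun e _ h P _ f => by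
        obtain ⟨P', _, p, hp⟩ := exists_presentable_epi (pullback.fst f e)
        obtain ⟨Q, hQ, q, hq, hT⟩ := h P' (p ≫ pullback.snd f e)
        refine ⟨Q, hQ, q ≫ p ≫ pullback.fst f e, ?_,
          T.epiModSerre.comp_mem _ _ hT (T.epiModSerre_of_epi _)⟩
        rw [Category.assoc, Category.assoc, pullback.condition, ← Category.assoc p,
          ← Category.assoc q, hq, zero_comp]
      prop_X₂_of_shortExact := fun {E} hE h₁ h₃ P _ f => by
        obtain ⟨Q, hQ, q, hq, hT⟩ := h₃ P (f ≫ E.g)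
        have := hE.mono_f
        have w : (q ≫ f) ≫ E.g = 0 := by rw [Category.assoc, hq]
        obtain ⟨Q', hQ', q', hq', hT'⟩ := h₁ Q (hE.exact.lift (q ≫ f) w)
        refine ⟨Q', hQ', q' ≫ q, ?_, T.epiModSerre.comp_mem _ _ hT' hT⟩
        rw [Category.assoc, ← hE.exact.lift_f (q ≫ f) w, reassoc_of% hq', zero_comp] }
  closed_directLimit J _ _ :=
    { colimitsOfShape_le := by
        rintro X ⟨p⟩ P _ f
        obtain ⟨j, g, hg⟩ := IsFinitelyPresentable.exists_hom_of_isColimit p.isColimit f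
        obtain ⟨Q, hQ, q, hq, hT⟩ := p.prop_diag_obj j P g
        exact ⟨Q, hQ, q, by rw [← hg, reassoc_of% hq, zero_comp], hT⟩ }

theorem IsFiniteType.le_finitelyTorsion (hS : IsFiniteType S) : S ≤ finitelyTorsion S := by
  have := hS.isLocalizing.isSerreClass
  intro X hX P _ f
  let A := sSup (presentableImages (kernel.ι f))
  have hA : S (cokernel A.arrow) :=
    prop_cokernel_of_fac (A.factorThru_arrow _ (sSup_presentableImages_factors (kernel.ι f)))
      (S.prop_of_mono (Abelian.factorThruCoimage f) hX)
  obtain ⟨_, ⟨Q, hQ, q, rfl⟩, hq⟩ := hS.exists_mem_prop_cokernel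
    (presentableImages_nonempty _) (directedOn_presentableImages _) hA
  refine ⟨Q, hQ, q ≫ kernel.ι f, by rw [Category.assoc, kernel.condition, comp_zero], ?_⟩
  change S.epiModSerre _
  rw [← imageSubobject_arrow_comp (q ≫ kernel.ι f)]
  exact S.epiModSerre.comp_mem _ _ (S.epiModSerre_of_epi _) hq

/-- A directed union `M` of closed objects embeds into a closed object `M'` with torsion cokernel.
A morphism from a finitely presentable object to `M'` restricts along some `q` to a morphism into a
member of the union, and the latter extends along `q` because that member is closed. -/
theorem closedObjects_of_isColimit (hL : IsLocalizing S) (hS : S ≤ finitelyTorsion S)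
    {J : Type v} [SmallCategory J] [IsFiltered J] {F : J ⥤ C} {c : Cocone F} (hc : IsColimit c)
    (hmono : ∀ (i j : J) (f : i ⟶ j), Mono (F.map f))
    (hF : ∀ j, closedObjects S (F.obj j)) : closedObjects S c.pt := by
  have := hL.isSerreClass
  have htf := rightOrthogonal_of_isColimit hS hc fun j => rightOrthogonal_of_closedObjects (hF j)
  obtain ⟨M, i, hM, hker, hcok⟩ := hL.exists_isoModSerre_closedObjects c.pt
  have : Mono i := Preadditive.mono_of_kernel_zero (htf _ hker)
  suffices h : cokernel.π i = 0 by
    have := Abelian.epi_of_cokernel_π_eq_zero i h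
    have := isIso_of_mono_of_epi i
    exact closedObjects_of_iso (asIso i) hM
  refine hom_ext_of_presentable fun P _ p => ?_
  obtain ⟨Q, _, q, hq, hQ⟩ := hS _ hcok P (p ≫ cokernel.π i)
  obtain ⟨j, l, hl⟩ := IsFinitelyPresentable.exists_hom_of_isColimit hc
    (Abelian.monoLift i (q ≫ p) (by rw [Category.assoc, hq]))
  have hlp : l ≫ c.ι.app j ≫ i = q ≫ p := by
    rw [← Category.assoc, hl, Abelian.monoLift_comp]
  have := hmono
  have := hc.mono_ι_app_of_isFiltered j
  obtain ⟨g, rfl⟩ := exists_comp_eq_of_closedObjects (hF j) hQ (g := l) <| by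
    rw [← cancel_mono (c.ι.app j ≫ i), Category.assoc, hlp, kernel.condition_assoc, zero_comp,
      zero_comp]
  have hgp : g ≫ c.ι.app j ≫ i - p = 0 := eq_zero_of_comp_eq_zero hQ
    (rightOrthogonal_of_closedObjects hM) <| by
      rw [Preadditive.comp_sub, ← hlp, Category.assoc, sub_self]
  rw [← sub_eq_zero.1 hgp]
  simp

theorem isFiniteType_iff_le_finitelyTorsion (hS : IsLocalizing S) :
    IsFiniteType S ↔ S ≤ finitelyTorsion S :=
  ⟨IsFiniteType.le_finitelyTorsion, fun h =>
    (isFiniteType_iff_closedObjects_of_isColimit hS).2 fun _ _ _ _ _ _ hc hmono hF =>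
      closedObjects_of_isColimit hS h hc hmono hF⟩

end FinitelyTorsion

section Lattice

variable {C : Type u} [Category.{v} C] {S Q : ObjectProperty C} {F : Set (ObjectProperty C)}

theorem inter_empty : inter (∅ : Set (ObjectProperty C)) = ⊤ := by
  ext
  simp [inter]

theorem inter_insert : inter (insert S F) = S ⊓ inter F := by
  ext
  simp [inter]

variable [Abelian C]

theorem isLocalizing_inter (hF : ∀ S ∈ F, IsLocalizing S) : IsLocalizing (inter F) where
  isSerreClass :=
    { exists_zero := ⟨_, isZero_zero C, fun S hS =>
        have := (hF S hS).isSerreClass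
        S.prop_of_isZero (isZero_zero C)⟩
      prop_of_mono := fun f _ h S hS =>
        have := (hF S hS).isSerreClass
        S.prop_of_mono f (h S hS)
      prop_of_epi := fun f _ h S hS =>
        have := (hF S hS).isSerreClass
        S.prop_of_epi f (h S hS)
      prop_X₂_of_shortExact := fun hE h₁ h₃ S hS =>
        have := (hF S hS).isSerreClass
        S.prop_X₂_of_shortExact hE (h₁ S hS) (h₃ S hS) }
  closed_directLimit J _ _ :=
    { colimitsOfShape_le := fun _ ⟨p⟩ S hS =>
        have := (hF S hS).closed_directLimit J
        S.prop_of_isColimit p.isColimit fun j => p.prop_diag_obj j S hS }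

theorem isLocalizing_top : IsLocalizing (⊤ : ObjectProperty C) :=
  inter_empty (C := C) ▸ isLocalizing_inter fun _ hS => hS.elim

theorem IsLocalizing.inf (hS : IsLocalizing S) (hQ : IsLocalizing Q) : IsLocalizing (S ⊓ Q) := by
  have : S ⊓ Q = inter {S, Q} := by
    ext
    simp [inter]
  exact this ▸ isLocalizing_inter (by simp [hS, hQ])

theorem isLocalizing_join : IsLocalizing (join F) := by
  have : join F = inter {S | IsLocalizing S ∧ union F ≤ S} := by
    ext
    simp [join, surd, inter]
  exact this ▸ isLocalizing_inter fun S hS => hS.1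

theorem le_join (hS : S ∈ F) : S ≤ join F :=
  fun _ hX _ _ hT => hT _ ⟨S, hS, hX⟩

theorem join_le (hQ : IsLocalizing Q) (h : ∀ S ∈ F, S ≤ Q) : join F ≤ Q :=
  fun _ hX => hX Q hQ fun _ ⟨S, hS, hY⟩ => h S hS _ hY

variable [IsLocallyFinitelyPresentable.{v} C] [IsGrothendieckAbelian.{v} C]

theorem isFiniteType_top : IsFiniteType (⊤ : ObjectProperty C) :=
  (isFiniteType_iff_le_finitelyTorsion isLocalizing_top).2 fun _ _ P _ _ =>
    ⟨P, inferInstance, 0, zero_comp, trivial⟩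

theorem IsFiniteType.inf (hS : IsFiniteType S) (hQ : IsFiniteType Q) : IsFiniteType (S ⊓ Q) := by
  refine (isFiniteType_iff_le_finitelyTorsion (hS.isLocalizing.inf hQ.isLocalizing)).2
    fun X hX P _ f => ?_
  obtain ⟨P₁, _, p₁, hp₁, h₁⟩ := hS.le_finitelyTorsion X hX.1 P f
  obtain ⟨P₂, _, p₂, hp₂, h₂⟩ := hQ.le_finitelyTorsion X hX.2 P f
  have := hS.isLocalizing.isSerreClass
  have := hQ.isLocalizing.isSerreClass
  refine ⟨P₁ ⊞ P₂, isFinitelyPresentable_biprod _ _, biprod.desc p₁ p₂, ?_,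
    prop_cokernel_of_fac (biprod.inl_desc p₁ p₂) h₁,
    prop_cokernel_of_fac (biprod.inr_desc p₁ p₂) h₂⟩
  ext <;> simp [hp₁, hp₂]

theorem isFiniteType_inter (hF : F.Finite) (h : ∀ S ∈ F, IsFiniteType S) :
    IsFiniteType (inter F) := by
  induction F, hF using Set.Finite.induction_on with
  | empty => exact inter_empty (C := C) ▸ isFiniteType_top
  | insert _ _ ih =>
    rw [Set.forall_mem_insert] at h
    rw [inter_insert]
    exact h.1.inf (ih h.2)

theorem isFiniteType_join (h : ∀ S ∈ F, IsFiniteType S) : IsFiniteType (join F) := by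
  have := (isLocalizing_join (F := F)).isSerreClass
  exact (isFiniteType_iff_le_finitelyTorsion isLocalizing_join).2 <|
    join_le (isLocalizing_finitelyTorsion (join F)) fun S hS =>
      (h S hS).le_finitelyTorsion.trans (finitelyTorsion_mono (le_join hS))

end Lattice

section Cocritical

variable {C : Type u} [Category.{v} C] [Abelian C] {S Q : ObjectProperty C} {V : C}

/-- An object outside `Q` all of whose proper quotients belong to `Q`. Cocritical objects exist in
abundance when `Q` is of finite type, and their injective hulls are indecomposable. -/
def IsCocritical (Q : ObjectProperty C) (V : C) : Prop :=
  ¬ Q V ∧ ∀ ⦃Y : C⦄ (a : V ⟶ Y) [Epi a], ¬ Mono a → Q Y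

theorem IsCocritical.rightOrthogonal [Q.IsSerreClass] (hV : IsCocritical Q V) :
    Q.rightOrthogonal V := by
  intro Y g hY
  by_contra hg
  have hcok : Q (cokernel g) := hV.2 (cokernel.π g) fun _ =>
    hg (zero_of_comp_mono _ (cokernel.condition g))
  exact hV.1 (prop_of_prop_kernel (cokernel.π g)
    (Q.prop_of_epi (Abelian.factorThruImage g) hY) hcok)

theorem IsCocritical.isUniform [Q.IsSerreClass] (hV : IsCocritical Q V) : IsUniform V := by
  refine ⟨fun h => hV.1 (Q.prop_of_isZero h), fun A a _ ha => ⟨inferInstance, fun Z g hag => ?_⟩⟩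
  by_contra hg
  have himage : Q (Abelian.image g) := hV.2 (Abelian.factorThruImage g) fun _ => hg <| by
    rw [← Abelian.image.fac g]
    infer_instance
  have : Mono (a ≫ Abelian.factorThruImage g) :=
    mono_of_mono_fac (h := a ≫ g) (by rw [Category.assoc, Abelian.image.fac])
  exact ha (hV.rightOrthogonal a (Q.prop_of_mono (a ≫ Abelian.factorThruImage g) himage))

variable [IsLocallyFinitelyPresentable.{v} C] [IsGrothendieckAbelian.{v} C]

theorem IsFiniteType.exists_isCocritical_cokernel (hQ : IsFiniteType Q) {P : C}
    [IsFinitelyPresentable.{v} P] {Z₀ : Subobject P} (h₀ : ¬ Q (cokernel Z₀.arrow)) :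
    ∃ Z, Z₀ ≤ Z ∧ IsCocritical Q (cokernel Z.arrow) := by
  have := hQ.isLocalizing.isSerreClass
  let T₀ : Set (Subobject P) := {Z | ¬ Q (cokernel Z.arrow)}
  have hbound (T : Set (Subobject P)) (hT : T ⊆ T₀) (hchain : IsChain (· ≤ ·) T)
      (hne : T.Nonempty) : sSup T ∈ T₀ := fun hsup =>
    let ⟨_, hB, hQB⟩ := hQ.exists_mem_prop_cokernel hne hchain.directedOn hsup
    hT hB hQB
  obtain ⟨Z, hle, hZ⟩ := zorn_le_nonempty₀ T₀ (fun T hT hchain A hA =>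
    ⟨sSup T, hbound T hT hchain ⟨A, hA⟩, fun _ => le_sSup⟩) Z₀ h₀
  refine ⟨Z, hle, hZ.prop, fun Y a _ ha => ?_⟩
  by_contra hY
  let K := kernelSubobject (cokernel.π Z.arrow ≫ a)
  have hK : ¬ Q (cokernel K.arrow) := fun hK => by
    have := epi_comp (cokernel.π Z.arrow) a
    let d := cokernel.desc K.arrow (cokernel.π Z.arrow ≫ a) (kernelSubobject_arrow_comp _)
    have : Epi d := epi_of_epi_fac (cokernel.π_desc _ _ _)
    exact hY (Q.prop_of_epi d hK)
  have hZK : Z ≤ K := le_kernelSubobject _ _ (by rw [cokernel.condition_assoc, zero_comp])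
  exact ha (mono_of_kernelSubobject_le a (hZ.le_of_ge hK hZK))

/-- Take `X` in `S` but not in `Q`. A finitely presentable piece of `X` that does not vanish modulo
`Q`-torsion has a cocritical quotient, whose injective hull is the required object. -/
theorem IsFiniteType.exists_indecomposable_injective (hQ : IsFiniteType Q) [S.IsSerreClass]
    (h : ¬ S ≤ Q) :
    ∃ E : C, indecomposableInjectives C E ∧ Q.rightOrthogonal E ∧ ¬ S.rightOrthogonal E := by
  have := hQ.isLocalizing.isSerreClass
  obtain ⟨X, hX, hXQ⟩ : ∃ X, S X ∧ ¬ Q X := by simpa [Pi.le_def] using h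
  let π := cokernel.π (torsion Q X).arrow
  obtain ⟨P, _, p, hp⟩ : ∃ (P : C) (_ : IsFinitelyPresentable.{v} P) (p : P ⟶ X),
      p ≫ π ≠ 0 := by
    by_contra! hzero
    have hπ : π = 0 := hom_ext_of_presentable fun P hP p => by rw [hzero P hP p, comp_zero]
    have := Abelian.epi_of_cokernel_π_eq_zero _ hπ
    exact hXQ (Q.prop_of_epi (torsion Q X).arrow (hQ.isLocalizing.prop_torsion X))
  obtain ⟨Z, hZ, hV⟩ := hQ.exists_isCocritical_cokernel (Z₀ := kernelSubobject p) fun hker =>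
    hp <| eq_zero_of_comp_eq_zero hker (hQ.isLocalizing.rightOrthogonal_cokernel_torsion X) <| by
      rw [← Category.assoc, kernelSubobject_arrow_comp, zero_comp]
  have hker : Z.Factors (kernel.ι p) := Subobject.factors_of_le _ hZ
    (kernelSubobject_factors _ _ (kernel.condition p))
  have hVS : S (cokernel Z.arrow) := prop_cokernel_of_fac (Z.factorThru_arrow _ hker)
    (S.prop_of_mono (Abelian.factorThruCoimage p) hX)
  obtain ⟨E, i, hE, hi⟩ := exists_injective_hull (cokernel Z.arrow)
  have := hi.mono
  exact ⟨E, ⟨hE, hV.isUniform.indecomposable_of_isEssentialMono hi⟩,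
    hi.rightOrthogonal hV.rightOrthogonal,
    fun hES => hV.isUniform.1 (IsZero.of_mono_eq_zero i (hES i hVS))⟩

end Cocritical

section Spectrum

variable {C : Type u} [Category.{v} C] [Abelian C]

theorem isLocalizing_leftOrthogonal_injective (E : C) [Injective E] :
    IsLocalizing (fun X : C => Subsingleton (X ⟶ E)) where
  isSerreClass :=
    { exists_zero := ⟨_, isZero_zero C, ⟨(isZero_zero C).eq_of_src⟩⟩
      prop_of_mono := fun i _ h => ⟨fun f g => by
        rw [← Injective.comp_factorThru f i, ← Injective.comp_factorThru g i,
          h.elim (Injective.factorThru f i) (Injective.factorThru g i)]⟩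
      prop_of_epi := fun p _ h => ⟨fun f g => by
        rw [← cancel_epi p, h.elim (p ≫ f) (p ≫ g)]⟩
      prop_X₂_of_shortExact := fun {T} hT h₁ h₃ => ⟨fun f g => by
        have := hT.epi_g
        rw [← hT.exact.g_desc f (h₁.elim _ _), ← hT.exact.g_desc g (h₁.elim _ _),
          h₃.elim (hT.exact.desc f _) (hT.exact.desc g _)]⟩ }
  closed_directLimit J _ _ :=
    { colimitsOfShape_le := fun _ ⟨p⟩ => ⟨fun f g => p.isColimit.hom_ext fun j =>
        (p.prop_diag_obj j).elim _ _⟩ }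

theorem InjSpectrum.mk_surjective : Function.Surjective (InjSpectrum.mk (C := C)) :=
  Quotient.mk_surjective

variable [IsGrothendieckAbelian.{v} C] {S Q : ObjectProperty C} {F : Set (ObjectProperty C)}

theorem mk_mem_openSet_iff [S.IsSerreClass] (E : (indecomposableInjectives C).FullSubcategory) :
    InjSpectrum.mk E ∈ openSet S ↔ ¬ S.rightOrthogonal E.obj := by
  constructor
  · rintro ⟨E', hE', ht⟩ h
    obtain ⟨e⟩ : Nonempty (E' ≅ E) := Quotient.exact hE'
    exact ht (torsion_eq_bot_iff.2
      (rightOrthogonal_of_mono h ((indecomposableInjectives C).ι.mapIso e).hom))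
  · exact fun h => ⟨E, rfl, by rwa [Ne, torsion_eq_bot_iff]⟩

theorem openSet_mono [S.IsSerreClass] [Q.IsSerreClass] (h : S ≤ Q) : openSet S ⊆ openSet Q := by
  intro x
  obtain ⟨E, rfl⟩ := InjSpectrum.mk_surjective x
  rw [mk_mem_openSet_iff, mk_mem_openSet_iff]
  exact fun hE hE' => hE fun X f hX => hE' f (h X hX)

theorem openSet_top : openSet (⊤ : ObjectProperty C) = Set.univ := by
  have := (isLocalizing_top (C := C)).isSerreClass
  refine Set.eq_univ_of_forall fun x => ?_
  obtain ⟨E, rfl⟩ := InjSpectrum.mk_surjective x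
  refine (mk_mem_openSet_iff E).2 fun h => ?_
  exact E.property.2.1 ((IsZero.iff_id_eq_zero _).2 (h _ trivial))

theorem openSet_inf (hS : IsLocalizing S) (hQ : IsLocalizing Q) :
    openSet (S ⊓ Q) = openSet S ∩ openSet Q := by
  have := hS.isSerreClass
  have := hQ.isSerreClass
  have := (hS.inf hQ).isSerreClass
  refine (Set.subset_inter (openSet_mono inf_le_left) (openSet_mono inf_le_right)).antisymm ?_
  intro x
  obtain ⟨E, rfl⟩ := InjSpectrum.mk_surjective x
  rw [Set.mem_inter_iff, mk_mem_openSet_iff, mk_mem_openSet_iff, mk_mem_openSet_iff, ← not_or]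
  have := E.property.1
  exact mt (isUniform_of_indecomposable_injective E.property.2).rightOrthogonal_or_of_inf

/-- The objects without nonzero morphisms to an injective `E` form a localizing subcategory, so if
it contains every member of `F`, then it contains their join. -/
theorem openSet_join (hF : ∀ S ∈ F, IsLocalizing S) :
    openSet (join F) = ⋃ S ∈ F, openSet S := by
  have := (isLocalizing_join (F := F)).isSerreClass
  refine subset_antisymm ?_ <| Set.iUnion₂_subset fun S hS =>
    have := (hF S hS).isSerreClass
    openSet_mono (le_join hS)
  intro x
  obtain ⟨E, rfl⟩ := InjSpectrum.mk_surjective x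
  have := E.property.1
  contrapose
  simp only [Set.mem_iUnion, not_exists]
  intro hE
  rw [mk_mem_openSet_iff, not_not]
  have hle : join F ≤ fun X : C => Subsingleton (X ⟶ E.obj) :=
    join_le (isLocalizing_leftOrthogonal_injective E.obj) fun S hS X hX => by
      have := (hF S hS).isSerreClass
      have hSE := hE S hS
      rw [mk_mem_openSet_iff, not_not] at hSE
      exact ⟨fun f g => by rw [hSE f hX, hSE g hX]⟩
  exact fun X f hX => (hle X hX).elim f 0

variable [IsLocallyFinitelyPresentable.{v} C]

theorem openSet_subset_openSet_iff [S.IsSerreClass] (hQ : IsFiniteType Q) :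
    openSet S ⊆ openSet Q ↔ S ≤ Q := by
  have := hQ.isLocalizing.isSerreClass
  refine ⟨fun h => ?_, openSet_mono⟩
  by_contra hn
  obtain ⟨E, hE, hQE, hSE⟩ := hQ.exists_indecomposable_injective hn
  exact (mk_mem_openSet_iff ⟨E, hE⟩).1 (h ((mk_mem_openSet_iff ⟨E, hE⟩).2 hSE)) hQE

theorem openSet_injOn : Set.InjOn (openSet (C := C)) {S | IsFiniteType S} := fun _ hS _ hQ h =>
  have := hS.isLocalizing.isSerreClass
  have := hQ.isLocalizing.isSerreClass
  le_antisymm ((openSet_subset_openSet_iff hQ).1 h.subset)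
    ((openSet_subset_openSet_iff hS).1 h.symm.subset)

variable (C) in
/-- The topology on the injective spectrum whose open sets are the `O(S)` with `S` a localizing
subcategory of finite type. -/
abbrev flTopology : TopologicalSpace (InjSpectrum C) where
  IsOpen U := ∃ S : ObjectProperty C, IsFiniteType S ∧ openSet S = U
  isOpen_univ := ⟨⊤, isFiniteType_top, openSet_top⟩
  isOpen_inter := by
    rintro _ _ ⟨S, hS, rfl⟩ ⟨Q, hQ, rfl⟩
    exact ⟨S ⊓ Q, hS.inf hQ, openSet_inf hS.isLocalizing hQ.isLocalizing⟩
  isOpen_sUnion s hs := by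
    refine ⟨join {S | IsFiniteType S ∧ openSet S ∈ s}, isFiniteType_join fun S hS => hS.1, ?_⟩
    rw [openSet_join fun S hS => hS.1.isLocalizing]
    refine subset_antisymm (Set.iUnion₂_subset fun S hS => Set.subset_sUnion_of_mem hS.2)
      (Set.sUnion_subset fun U hU => ?_)
    obtain ⟨S, hS, rfl⟩ := hs U hU
    exact Set.subset_iUnion₂_of_subset S ⟨hS, hU⟩ subset_rfl

end Spectrum

end FiniteLocalization

theorem mainTheorem4 (C : Type u) [Category.{v} C] [Abelian C] [IsGrothendieckAbelian.{v} C]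
    [IsLocallyFinitelyPresentable.{v} C] :
    (∃ fl : TopologicalSpace (FiniteLocalization.InjSpectrum C),
      (∀ U : Set (FiniteLocalization.InjSpectrum C), IsOpen[fl] U ↔
        ∃ S : ObjectProperty C, FiniteLocalization.IsFiniteType S ∧
          FiniteLocalization.openSet S = U) ∧
      Set.BijOn (fun S : ObjectProperty C => FiniteLocalization.openSet S)
        {S | FiniteLocalization.IsFiniteType S} {U | IsOpen[fl] U} ∧
      (∀ S Q : ObjectProperty C, FiniteLocalization.IsFiniteType S →
        FiniteLocalization.IsFiniteType Q →
        (S ≤ Q ↔ FiniteLocalization.openSet S ⊆ FiniteLocalization.openSet Q))) ∧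
    (∀ F : Set (ObjectProperty C), F.Finite →
      (∀ S ∈ F, FiniteLocalization.IsFiniteType S) →
      FiniteLocalization.IsFiniteType (FiniteLocalization.inter F)) ∧
    (∀ F : Set (ObjectProperty C), (∀ S ∈ F, FiniteLocalization.IsFiniteType S) →
      FiniteLocalization.IsFiniteType (FiniteLocalization.join F)) := by
  refine ⟨⟨FiniteLocalization.flTopology C, fun _ => Iff.rfl,
    ⟨fun S hS => ⟨S, hS, rfl⟩, FiniteLocalization.openSet_injOn, fun _ hU => hU⟩,
    fun S Q hS hQ => ?_⟩, fun _ => FiniteLocalization.isFiniteType_inter,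
    fun _ => FiniteLocalization.isFiniteType_join⟩
  have := hS.isLocalizing.isSerreClass
  exact (FiniteLocalization.openSet_subset_openSet_iff hQ).symm
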